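/- Let $1\le p<\infty$ be real, let $E$ be a (real) Banach lattice and suppose that at least one of the following holds: (i) the dual $E^*$ has cotype $p$, i.e. $p\ge 2$ and there is a constant $C>0$ such that for every finite family $f_1,\dots,f_n\in E^*$ $$\Big(\sum_{k=1}^n\|f_k\|^p\Big)^{1/p}\le C\Big(\int_0^1\Big\|\sum_{k=1}^n r_k(t)f_k\Big\|^2dt\Big)^{1/2},\qquad r_k(t)=\operatorname{sign}\sin(2^k\pi t);$$ (ii) $E$ has the disjoint property of order $p$, i.e. every norm bounded disjoint sequence in $E$ is weakly $p$-summable. Here $(x_n)_n$ is disjoint if $|x_n|\wedge|x_m|=0$ for all $n\ne m$, and weakly $p$-summable if $\sum_n|f(x_n)|^p<\infty$ for every $f\in E^*$. Then, for every (real) Banach space $X$ and every bounded linear operator $T\colon E\to X$, the operator $T$ is disjoint $p$-convergent (i.e. $\|T(x_n)\|\to0$ for every disjoint weakly $p$-summable sequence $(x_n)_n$ in $E$) if and only if $T$ is almost Dunford–Pettis (i.e. $\|T(x_n)\|\to0$ for every disjoint weakly null sequence $(x_n)_n$ in $E$). -/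

import Mathlib

open Filter Topology

/-- Pairwise disjointness of a sequence in a vector lattice: `|x n| ∧ |x m| = 0` for `n ≠ m`. -/
def IsDisjointSeq {E : Type*} [Lattice E] [AddCommGroup E] (x : ℕ → E) : Prop :=
  ∀ n m : ℕ, n ≠ m → |x n| ⊓ |x m| = 0

/-- `(x n)` is weakly `p`-summable: `(f (x n))` belongs to `ℓ_p` for every `f` in the dual. -/
def IsWeaklySummable {X : Type*} [NormedAddCommGroup X] [NormedSpace ℝ X]
    (p : ℝ) (x : ℕ → X) : Prop :=
  ∀ f : StrongDual ℝ X, Summable fun n => |f (x n)| ^ p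

/-- `(x n)` converges weakly to `0`. -/
def IsWeaklyNull {X : Type*} [NormedAddCommGroup X] [NormedSpace ℝ X] (x : ℕ → X) : Prop :=
  ∀ f : StrongDual ℝ X, Tendsto (fun n => f (x n)) atTop (𝓝 0)

/-- The Rademacher functions `r_k(t) = sign (sin (2 ^ k * π * t))`; the Rademacher sequence
is `r_1, r_2, …`. -/
noncomputable def rademacher (k : ℕ) (t : ℝ) : ℝ :=
  Real.sign (Real.sin (2 ^ k * Real.pi * t))

/-- Cotype `p` of a normed space, where `2 ≤ p < ∞`. -/
def HasCotype (p : ℝ) (X : Type*) [NormedAddCommGroup X] [NormedSpace ℝ X] : Prop :=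
  2 ≤ p ∧ ∃ C : ℝ, 0 < C ∧ ∀ (n : ℕ) (x : Fin n → X),
    (∑ k, ‖x k‖ ^ p) ^ (1 / p) ≤
      C * (∫ t in (0 : ℝ)..1, ‖∑ k : Fin n, rademacher (k + 1) t • x k‖ ^ 2) ^ (1 / 2 : ℝ)

/-- The disjoint property of order `p`: every norm bounded disjoint sequence is weakly
`p`-summable. -/
def HasDisjointProperty (p : ℝ) (E : Type*) [NormedAddCommGroup E] [NormedSpace ℝ E]
    [Lattice E] : Prop :=
  ∀ x : ℕ → E, IsDisjointSeq x → (∃ M : ℝ, ∀ n, ‖x n‖ ≤ M) → IsWeaklySummable p x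

/-- A bounded operator is disjoint `p`-convergent if it sends disjoint weakly `p`-summable
sequences to norm null sequences. -/
def IsDisjointConvergent {E X : Type*} [NormedAddCommGroup E] [NormedSpace ℝ E] [Lattice E]
    [NormedAddCommGroup X] [NormedSpace ℝ X] (p : ℝ) (T : E →L[ℝ] X) : Prop :=
  ∀ x : ℕ → E, IsDisjointSeq x → IsWeaklySummable p x →
    Tendsto (fun n => ‖T (x n)‖) atTop (𝓝 0)

/-- A bounded operator is almost Dunford-Pettis if it sends disjoint weakly null sequences to
norm null sequences. -/
def IsAlmostDunfordPettis {E X : Type*} [NormedAddCommGroup E] [NormedSpace ℝ E] [Lattice E]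
    [NormedAddCommGroup X] [NormedSpace ℝ X] (T : E →L[ℝ] X) : Prop :=
  ∀ x : ℕ → E, IsDisjointSeq x → IsWeaklyNull x → Tendsto (fun n => ‖T (x n)‖) atTop (𝓝 0)

/-! Weak `p`-summability implies weak nullity, which gives one direction at once. Conversely, weakly
null sequences are bounded, so under (ii) the disjoint ones are weakly `p`-summable. The work is (i)
⇒ (ii).

For `f` in the dual and a bounded disjoint `(x k)`, let `g k` be the component of `|f|` on the ideal
generated by `|x k|`. Then `|f (x k)| ≤ g k |x k| ≤ M ‖g k‖`. Disjointness gives `∑ g k y ≤ ‖f‖ ‖y‖`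
for `y ≥ 0` (`sum_idealModulus_le`), so every Rademacher sum of the `g k` has norm at most `‖f‖`,
and cotype bounds `∑ ‖g k‖ ^ p` by `(C ‖f‖) ^ p`. -/

/-- A function that is additive on the positive cone extends to an additive map on the lattice
ordered group. -/
theorem exists_addMonoidHom_of_add_on_nonneg {E : Type*} [AddCommGroup E] [Lattice E]
    [IsOrderedAddMonoid E] (φ : E → ℝ)
    (hadd : ∀ y z : E, 0 ≤ y → 0 ≤ z → φ (y + z) = φ y + φ z) :
    ∃ L : E →+ ℝ, ∀ x, L x = φ x⁺ - φ x⁻ := by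
  refine ⟨AddMonoidHom.mk' (fun x => φ x⁺ - φ x⁻) fun x y => ?_, fun x => rfl⟩
  -- Written without subtraction, so that additivity on the cone applies to both sides.
  have key : (x + y)⁺ + (x⁻ + y⁻) = (x + y)⁻ + (x⁺ + y⁺) := by
    have h := posPart_sub_negPart (x + y)
    have hx := posPart_sub_negPart x
    have hy := posPart_sub_negPart y
    have h1 : (x + y)⁺ - (x + y)⁻ = (x⁺ - x⁻) + (y⁺ - y⁻) := by rw [h, hx, hy]
    rw [sub_eq_iff_eq_add] at h1
    rw [h1]; abel
  have h2 := congrArg φ key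
  rw [hadd _ _ (posPart_nonneg _) (add_nonneg (negPart_nonneg _) (negPart_nonneg _)),
    hadd _ _ (negPart_nonneg _) (negPart_nonneg _),
    hadd _ _ (negPart_nonneg _) (add_nonneg (posPart_nonneg _) (posPart_nonneg _)),
    hadd _ _ (posPart_nonneg _) (posPart_nonneg _)] at h2
  linarith

/-- Riesz decomposition: if `|z| ≤ a + b` with `a, b ≥ 0`, then `z` splits into pieces dominated
by `a` and `b`, each of modulus at most `|z|`. -/
theorem exists_add_eq_abs_le_of_abs_le_add {E : Type*} [AddCommGroup E] [Lattice E]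
    [IsOrderedAddMonoid E] {z a b : E} (ha : 0 ≤ a) (hb : 0 ≤ b) (h : |z| ≤ a + b) :
    ∃ z₁ z₂, z₁ + z₂ = z ∧ |z₁| ≤ a ∧ |z₂| ≤ b ∧ |z₁| ≤ |z| ∧ |z₂| ≤ |z| := by
  have hz := abs_le'.1 h
  have hzz : z ≤ |z| := le_abs_self z
  have hnz : -z ≤ |z| := neg_le_abs z
  have h0 : 0 ≤ |z| := abs_nonneg z
  have hna : -a ≤ a := (neg_nonpos.2 ha).trans ha
  have hab : z - b ≤ a := sub_le_iff_le_add.2 hz.1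
  have hab' : -a ≤ z + b := by
    have := hz.2
    rw [neg_le_iff_add_nonneg] at this ⊢
    calc (0 : E) ≤ _ := this
      _ = _ := by abel
  have hlow : z ⊓ 0 ≤ (z ⊓ a) ⊔ (-a) := (inf_le_inf_left z ha).trans le_sup_left
  have hup : (z ⊓ a) ⊔ (-a) ≤ z ⊔ 0 :=
    sup_le (inf_le_left.trans le_sup_left) ((neg_nonpos.2 ha).trans le_sup_right)
  have hsum : z ⊓ 0 + z ⊔ 0 = z := by rw [inf_add_sup, add_zero]
  have hsup : z ⊔ 0 ≤ |z| := sup_le hzz h0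
  have hinf : -|z| ≤ z ⊓ 0 := le_inf (neg_le.1 hnz) (neg_nonpos.2 h0)
  -- Truncate `z` to `[-a, a]`. The truncation lies between `z ⊓ 0` and `z ⊔ 0`, so both pieces have
  -- modulus at most `|z|`.
  refine ⟨(z ⊓ a) ⊔ (-a), z - (z ⊓ a) ⊔ (-a), by abel, ?_, ?_, ?_, ?_⟩
  · exact abs_le'.2 ⟨sup_le inf_le_right hna, neg_le.1 le_sup_right⟩
  · refine abs_le'.2 ⟨?_, ?_⟩
    · rw [sub_le_comm]
      exact (le_inf (sub_le_self z hb) hab).trans le_sup_left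
    · rw [neg_sub, sub_le_iff_le_add]
      refine sup_le (inf_le_left.trans (le_add_of_nonneg_left hb)) ?_
      rwa [add_comm]
  · exact abs_le'.2 ⟨hup.trans hsup, neg_le.1 (hinf.trans hlow)⟩
  · refine abs_le'.2 ⟨?_, ?_⟩
    · rw [sub_le_comm]
      refine le_trans ?_ hlow
      rw [sub_le_iff_le_add]
      nth_rw 1 [← hsum]
      gcongr
    · rw [neg_sub, sub_le_iff_le_add]
      refine hup.trans ?_
      have h1 : z ⊔ 0 = z - z ⊓ 0 := eq_sub_of_add_eq' hsum
      rw [h1, sub_eq_neg_add]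
      gcongr
      exact neg_le.1 hinf

/-- Binary infima with a fixed nonnegative element are subadditive on the positive cone. -/
theorem inf_add_le_inf_add_inf {E : Type*} [AddCommGroup E] [Lattice E] [IsOrderedAddMonoid E]
    {a b c : E} (ha : 0 ≤ a) (hb : 0 ≤ b) (hc : 0 ≤ c) : a ⊓ (b + c) ≤ a ⊓ b + a ⊓ c := by
  rw [inf_add, add_inf, add_inf]
  refine le_inf (le_inf ?_ ?_) (le_inf ?_ ?_)
  · exact inf_le_left.trans (le_add_of_nonneg_left ha)
  · exact inf_le_left.trans (le_add_of_nonneg_right hc)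
  · exact inf_le_left.trans (le_add_of_nonneg_left hb)
  · exact inf_le_right

theorem inf_nsmul_eq_zero {E : Type*} [AddCommGroup E] [Lattice E] [IsOrderedAddMonoid E]
    {a b : E} (ha : 0 ≤ a) (hb : 0 ≤ b) (h : a ⊓ b = 0) (m : ℕ) : a ⊓ m • b = 0 := by
  induction m with
  | zero => simpa using ha
  | succ m ih =>
    refine le_antisymm ?_ (le_inf ha (nsmul_nonneg hb _))
    rw [succ_nsmul]
    refine (inf_add_le_inf_add_inf ha (nsmul_nonneg hb _) hb).trans ?_
    rw [ih, h, add_zero]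

/-- A finite sum of pairwise disjoint nonnegative elements below `y` is below `y`. -/
theorem sum_le_of_pairwise_inf_eq_zero {E ι : Type*} [AddCommGroup E] [Lattice E]
    [IsOrderedAddMonoid E] {w : ι → E} (hw : ∀ i, 0 ≤ w i)
    (hd : Pairwise fun i j => w i ⊓ w j = 0) {y : E} (hy : 0 ≤ y) (hwy : ∀ i, w i ≤ y)
    (s : Finset ι) : ∑ i ∈ s, w i ≤ y := by
  classical
  have hdisj : ∀ (s : Finset ι) (i : ι), i ∉ s → w i ⊓ ∑ j ∈ s, w j = 0 := by
    intro s i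
    induction s using Finset.induction_on with
    | empty => intro _; simpa using hw i
    | insert j s hj ih =>
      intro hi
      rw [Finset.mem_insert, not_or] at hi
      rw [Finset.sum_insert hj]
      refine le_antisymm ?_
        (le_inf (hw i) (add_nonneg (hw j) (Finset.sum_nonneg fun k _ => hw k)))
      refine (inf_add_le_inf_add_inf (hw i) (hw j) (Finset.sum_nonneg fun k _ => hw k)).trans ?_
      rw [hd hi.1, ih hi.2, add_zero]
  induction s using Finset.induction_on with
  | empty => simpa using hy
  | insert i s hi ih =>
    rw [Finset.sum_insert hi, ← inf_add_sup, hdisj s i hi, zero_add]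
    exact sup_le (hwy i) ih

section BandComponent

variable {E : Type*} [NormedAddCommGroup E] [NormedSpace ℝ E] [Lattice E]

/-- The values of `f` on the part of the order interval `[-y, y]` lying in the principal ideal
generated by `u`. -/
def idealValues (f : StrongDual ℝ E) (u y : E) : Set ℝ :=
  {r | ∃ (z : E) (m : ℕ), |z| ≤ y ∧ |z| ≤ m • u ∧ f z = r}

/-- The value at `y ≥ 0` of the component of the modulus `|f|` carried by the principal ideal
generated by `u`. -/
noncomputable def idealModulus (f : StrongDual ℝ E) (u y : E) : ℝ :=
  sSup (idealValues f u y)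

theorem bddAbove_idealValues [HasSolidNorm E] (f : StrongDual ℝ E) (u y : E) :
    BddAbove (idealValues f u y) := by
  refine ⟨‖f‖ * ‖y‖, ?_⟩
  rintro _ ⟨z, m, hz, -, rfl⟩
  refine (le_abs_self _).trans ((f.le_opNorm z).trans ?_)
  gcongr
  exact norm_le_norm_of_abs_le_abs (hz.trans (le_abs_self y))

theorem abs_apply_le_idealModulus_abs [HasSolidNorm E] (f : StrongDual ℝ E) (x : E) :
    |f x| ≤ idealModulus f |x| |x| := by
  refine abs_le'.2 ⟨?_, ?_⟩
  · exact le_csSup (bddAbove_idealValues f _ _) ⟨x, 1, le_rfl, by simp, rfl⟩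
  · exact le_csSup (bddAbove_idealValues f _ _) ⟨-x, 1, by simp, by simp, map_neg f x⟩

variable [IsOrderedAddMonoid E]

theorem zero_mem_idealValues (f : StrongDual ℝ E) (u : E) {y : E} (hy : 0 ≤ y) :
    0 ∈ idealValues f u y :=
  ⟨0, 0, by simpa using hy, by simp, map_zero f⟩

/-- The Riesz pieces of `w` are dominated by `|w|`, hence stay in the ideal of `u`. -/
theorem idealValues_add (f : StrongDual ℝ E) (u : E) {y z : E} (hy : 0 ≤ y)
    (hz : 0 ≤ z) :
    idealValues f u (y + z) = Set.image2 (· + ·) (idealValues f u y) (idealValues f u z) := by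
  ext r
  constructor
  · rintro ⟨w, m, hw, hwm, rfl⟩
    obtain ⟨w₁, w₂, rfl, h1, h2, h3, h4⟩ := exists_add_eq_abs_le_of_abs_le_add hy hz hw
    exact ⟨_, ⟨w₁, m, h1, h3.trans hwm, rfl⟩, _, ⟨w₂, m, h2, h4.trans hwm, rfl⟩,
      (map_add f _ _).symm⟩
  · rintro ⟨_, ⟨w₁, m₁, h1, h1m, rfl⟩, _, ⟨w₂, m₂, h2, h2m, rfl⟩, rfl⟩
    refine ⟨w₁ + w₂, m₁ + m₂, (abs_add_le _ _).trans (add_le_add h1 h2), ?_, map_add f _ _⟩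
    rw [add_nsmul]
    exact (abs_add_le _ _).trans (add_le_add h1m h2m)

variable [HasSolidNorm E]

theorem idealModulus_nonneg (f : StrongDual ℝ E) (u : E) {y : E} (hy : 0 ≤ y) :
    0 ≤ idealModulus f u y :=
  le_csSup (bddAbove_idealValues f u y) (zero_mem_idealValues f u hy)

theorem idealModulus_add (f : StrongDual ℝ E) (u : E) {y z : E} (hy : 0 ≤ y)
    (hz : 0 ≤ z) :
    idealModulus f u (y + z) = idealModulus f u y + idealModulus f u z := by
  unfold idealModulus
  rw [idealValues_add f u hy hz]
  exact csSup_add ⟨0, zero_mem_idealValues f u hy⟩ (bddAbove_idealValues f u y)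
    ⟨0, zero_mem_idealValues f u hz⟩ (bddAbove_idealValues f u z)

/-- The components of `|f|` carried by pairwise disjoint elements add up to at most `|f|`. -/
theorem sum_idealModulus_le (f : StrongDual ℝ E) {ι : Type*} {u : ι → E} (hu : ∀ i, 0 ≤ u i)
    (hd : Pairwise fun i j => u i ⊓ u j = 0) (s : Finset ι) {y : E} (hy : 0 ≤ y) :
    ∑ i ∈ s, idealModulus f (u i) y ≤ ‖f‖ * ‖y‖ := by
  refine le_of_forall_pos_le_add fun ε hε => ?_
  -- The `+ 1` covers empty `s`.
  have hδ : 0 < ε / (s.card + 1) := by positivity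
  have hex : ∀ i, ∃ (z : E) (m : ℕ), |z| ≤ y ∧ |z| ≤ m • u i ∧
      idealModulus f (u i) y < f z + ε / (s.card + 1) := by
    intro i
    obtain ⟨_, ⟨z, m, h1, h2, rfl⟩, h3⟩ := exists_lt_of_lt_csSup
      ⟨0, zero_mem_idealValues f (u i) hy⟩ (sub_lt_self (idealModulus f (u i) y) hδ)
    exact ⟨z, m, h1, h2, sub_lt_iff_lt_add.1 h3⟩
  choose z m hzy hzm hfz using hex
  -- Near-maximizers inherit disjointness from the `u i`, so their sum still lies in `[-y, y]` and
  -- one evaluation of `f` bounds all the suprema.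
  have hzd : Pairwise fun i j => |z i| ⊓ |z j| = 0 := by
    intro i j hij
    refine le_antisymm ?_ (le_inf (abs_nonneg _) (abs_nonneg _))
    refine (inf_le_inf (hzm i) (hzm j)).trans_eq ?_
    refine inf_nsmul_eq_zero (nsmul_nonneg (hu i) _) (hu j) ?_ _
    rw [inf_comm]
    exact inf_nsmul_eq_zero (hu j) (hu i) (hd hij.symm) _
  have habs : |∑ i ∈ s, z i| ≤ y := by
    have htri : |∑ i ∈ s, z i| ≤ ∑ i ∈ s, |z i| :=
      Finset.le_sum_of_subadditive (fun x : E => |x|) (by simp) abs_add_le s z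
    exact htri.trans (sum_le_of_pairwise_inf_eq_zero (fun i => abs_nonneg _) hzd hy hzy s)
  calc ∑ i ∈ s, idealModulus f (u i) y
      ≤ ∑ i ∈ s, (f (z i) + ε / (s.card + 1)) := Finset.sum_le_sum fun i _ => (hfz i).le
    _ = f (∑ i ∈ s, z i) + s.card * (ε / (s.card + 1)) := by
        rw [Finset.sum_add_distrib, map_sum, Finset.sum_const, nsmul_eq_mul]
    _ ≤ ‖f‖ * ‖y‖ + ε := by
        refine add_le_add ?_ ?_
        · refine (le_abs_self _).trans ((f.le_opNorm _).trans ?_)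
          gcongr
          exact norm_le_norm_of_abs_le_abs (habs.trans (le_abs_self y))
        · rw [mul_div_assoc', div_le_iff₀ (by positivity)]
          nlinarith

theorem exists_dual_eq_idealModulus (f : StrongDual ℝ E) {u : E} (hu : 0 ≤ u) :
    ∃ g : StrongDual ℝ E, ∀ x,
      |g x| ≤ idealModulus f u |x| ∧ (0 ≤ x → g x = idealModulus f u x) := by
  obtain ⟨L, hL⟩ := exists_addMonoidHom_of_add_on_nonneg (idealModulus f u)
    fun _ _ => idealModulus_add f u
  have habs : ∀ x, |L x| ≤ idealModulus f u |x| := by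
    intro x
    have h1 := idealModulus_nonneg f u (posPart_nonneg x)
    have h2 := idealModulus_nonneg f u (negPart_nonneg x)
    rw [← posPart_add_negPart x, idealModulus_add f u (posPart_nonneg x) (negPart_nonneg x), hL]
    exact abs_le.2 ⟨by linarith, by linarith⟩
  have hle : ∀ x, ‖L x‖ ≤ ‖f‖ * ‖x‖ := by
    intro x
    -- The one-member family gives continuity.
    have h := sum_idealModulus_le f (u := fun _ : Unit => u) (fun _ => hu)
      (fun i j h => (h (Subsingleton.elim i j)).elim) Finset.univ (abs_nonneg x)
    rw [norm_abs_eq_norm, Fintype.sum_unique] at h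
    exact (habs x).trans h
  refine ⟨L.toRealLinearMap (AddMonoidHomClass.continuous_of_bound L _ hle), fun x => ⟨habs x, ?_⟩⟩
  intro hx
  have h0 : idealModulus f u 0 = 0 := by
    have := idealModulus_add f u (le_refl (0 : E)) le_rfl
    rw [add_zero] at this
    linarith
  change L x = _
  rw [hL, posPart_of_nonneg hx, negPart_of_nonneg hx, h0, sub_zero]

end BandComponent

theorem abs_rademacher_le_one (k : ℕ) (t : ℝ) : |rademacher k t| ≤ 1 := by
  unfold rademacher
  rcases Real.sign_apply_eq (Real.sin (2 ^ k * Real.pi * t)) with h | h | h <;> rw [h] <;> simp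

/-- If the dual of a normed lattice has cotype `p`, the lattice has the disjoint property of
order `p`. -/
theorem HasCotype.hasDisjointProperty {E : Type*} [NormedAddCommGroup E] [NormedSpace ℝ E]
    [Lattice E] [IsOrderedAddMonoid E] [HasSolidNorm E] {p : ℝ}
    (h : HasCotype p (StrongDual ℝ E)) : HasDisjointProperty p E := by
  obtain ⟨hp, C, hC, hcot⟩ := h
  have hp0 : 0 < p := by linarith
  rintro x hx ⟨M, hM⟩ f
  have hM0 : 0 ≤ M := (norm_nonneg _).trans (hM 0)
  choose g hg using fun k => exists_dual_eq_idealModulus f (abs_nonneg (x k))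
  have hfx : ∀ k, |f (x k)| ≤ ‖g k‖ * M := by
    intro k
    calc |f (x k)| ≤ idealModulus f |x k| |x k| := abs_apply_le_idealModulus_abs f (x k)
      _ = g k |x k| := ((hg k _).2 (abs_nonneg _)).symm
      _ ≤ ‖g k‖ * ‖|x k|‖ := (le_abs_self _).trans ((g k).le_opNorm _)
      _ ≤ ‖g k‖ * M := by rw [norm_abs_eq_norm]; gcongr; exact hM k
  have hnorm : ∀ (n : ℕ) (t : ℝ), ‖∑ k : Fin n, rademacher (k + 1) t • g k‖ ≤ ‖f‖ := by
    intro n t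
    refine ContinuousLinearMap.opNorm_le_bound _ (norm_nonneg f) fun y => ?_
    have hd : Pairwise fun i j : Fin n => |x i| ⊓ |x j| = 0 :=
      fun i j hij => hx _ _ fun h => hij (Fin.ext h)
    have hsum := sum_idealModulus_le f (fun i : Fin n => abs_nonneg (x i)) hd Finset.univ
      (abs_nonneg y)
    rw [norm_abs_eq_norm] at hsum
    refine le_trans ?_ hsum
    rw [sum_apply]
    refine (norm_sum_le _ _).trans (Finset.sum_le_sum fun k _ => ?_)
    rw [smul_apply, norm_smul]
    refine (mul_le_of_le_one_left (norm_nonneg _) (abs_rademacher_le_one _ _)).trans ?_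
    exact (hg k y).1
  have hbound : ∀ n : ℕ, ∑ k : Fin n, ‖g k‖ ^ p ≤ (C * ‖f‖) ^ p := by
    intro n
    have hint : ∫ t in (0 : ℝ)..1, ‖∑ k : Fin n, rademacher (k + 1) t • g k‖ ^ 2 ≤ ‖f‖ ^ 2 := by
      have h := intervalIntegral.norm_integral_le_of_norm_le_const (a := 0) (b := 1)
        (C := ‖f‖ ^ 2) (f := fun t => ‖∑ k : Fin n, rademacher (k + 1) t • g k‖ ^ 2)
        (fun t _ => by
          rw [norm_pow, norm_norm]
          exact pow_le_pow_left₀ (norm_nonneg _) (hnorm n t) 2)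
      rw [sub_zero, abs_one, mul_one] at h
      exact (le_abs_self _).trans h
    have hint0 : 0 ≤ ∫ t in (0 : ℝ)..1, ‖∑ k : Fin n, rademacher (k + 1) t • g k‖ ^ 2 :=
      intervalIntegral.integral_nonneg zero_le_one fun t _ => by positivity
    have h1 := (hcot n fun k => g k).trans
      (mul_le_mul_of_nonneg_left (Real.rpow_le_rpow hint0 hint (by norm_num)) hC.le)
    rw [← Real.sqrt_eq_rpow, Real.sqrt_sq (norm_nonneg f)] at h1
    have hs0 : 0 ≤ ∑ k : Fin n, ‖g k‖ ^ p :=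
      Finset.sum_nonneg fun k _ => Real.rpow_nonneg (norm_nonneg _) _
    have h2 := Real.rpow_le_rpow (Real.rpow_nonneg hs0 _) h1 hp0.le
    rwa [← Real.rpow_mul hs0, one_div_mul_cancel hp0.ne', Real.rpow_one] at h2
  refine summable_of_sum_range_le (c := (C * ‖f‖) ^ p * M ^ p)
    (fun k => Real.rpow_nonneg (abs_nonneg _) _) fun n => ?_
  calc ∑ k ∈ Finset.range n, |f (x k)| ^ p
      ≤ ∑ k ∈ Finset.range n, ‖g k‖ ^ p * M ^ p := by
        refine Finset.sum_le_sum fun k _ => ?_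
        rw [← Real.mul_rpow (norm_nonneg _) hM0]
        exact Real.rpow_le_rpow (abs_nonneg _) (hfx k) hp0.le
    _ = (∑ k : Fin n, ‖g k‖ ^ p) * M ^ p := by
        rw [← Finset.sum_mul, Fin.sum_univ_eq_sum_range (fun k => ‖g k‖ ^ p)]
    _ ≤ (C * ‖f‖) ^ p * M ^ p := by
        gcongr
        exact hbound n

/-- Weakly null sequences are norm bounded. -/
theorem IsWeaklyNull.exists_norm_le {X : Type*} [NormedAddCommGroup X] [NormedSpace ℝ X]
    {x : ℕ → X} (hx : IsWeaklyNull x) : ∃ M : ℝ, ∀ n, ‖x n‖ ≤ M := by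
  -- Uniform boundedness acts on the dual, which is complete even if `X` is not.
  obtain ⟨M, hM⟩ := banach_steinhaus (g := fun n => NormedSpace.inclusionInDoubleDual ℝ X (x n))
    fun f => by
      obtain ⟨c, hc⟩ := (hx f).norm.bddAbove_range
      exact ⟨c, fun n => hc ⟨n, rfl⟩⟩
  refine ⟨M, fun n => ?_⟩
  exact ((NormedSpace.inclusionInDoubleDualLi ℝ).norm_map (x n)).symm.trans_le (hM n)

theorem IsWeaklySummable.isWeaklyNull {X : Type*} [NormedAddCommGroup X] [NormedSpace ℝ X]
    {p : ℝ} (hp : 0 < p) {x : ℕ → X} (hx : IsWeaklySummable p x) : IsWeaklyNull x := by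
  intro f
  have h := (hx f).tendsto_atTop_zero.rpow_const (p := p⁻¹) (Or.inr (inv_nonneg.2 hp.le))
  rw [Real.zero_rpow (inv_ne_zero hp.ne')] at h
  refine squeeze_zero_norm (fun n => ?_) h
  rw [Real.rpow_rpow_inv (abs_nonneg _) hp.ne', Real.norm_eq_abs]

/-- The instances on `E` say that it is a (real) Banach lattice. -/
theorem theorem2p7 {E X : Type*}
    [NormedAddCommGroup E] [NormedSpace ℝ E] [CompleteSpace E]
    [Lattice E] [IsOrderedAddMonoid E] [IsOrderedModule ℝ E] [HasSolidNorm E]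
    [NormedAddCommGroup X] [NormedSpace ℝ X] [CompleteSpace X]
    (p : ℝ) (hp : 1 ≤ p)
    (hE : HasCotype p (StrongDual ℝ E) ∨ HasDisjointProperty p E)
    (T : E →L[ℝ] X) :
    IsDisjointConvergent p T ↔ IsAlmostDunfordPettis T := by
  have hdp : HasDisjointProperty p E := hE.elim HasCotype.hasDisjointProperty id
  constructor
  · exact fun hT x hxd hx => hT x hxd (hdp x hxd hx.exists_norm_le)
  · exact fun hT x hxd hx => hT x hxd (hx.isWeaklyNull (by linarith))
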